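/- Let $V=\mathrm{Mat}(2\times 2,\mathbb C)^4\cong\mathbb C^{16}$ and let $$X=\{(A_0,A_1,A_2,A_3)\in V \mid \det A_i=0 \text{ and } A_iA_{i+1}=0 \text{ for all } i\},$$ where the index $i$ is taken modulo $4$. For a smooth locally closed subvariety $S\subset V$ let $\Lambda_S=\overline{T^*_SV}\subset T^*V=V\times V^*$ be the closure of its conormal bundle; it has dimension $\dim V$ whenever $S\neq\emptyset$. Two disjoint smooth locally closed subvarieties $S,T$ are said to meet microlocally in codimension one if $\dim_{\mathbb C}(\Lambda_S\cap\Lambda_T)=\dim V-1$ (and $\dim\Lambda_S=\dim\Lambda_T=\dim V$). Let $S$ be the smooth part of $X$. Then $S$ and $\{0\}$ meet microlocally in codimension one, that is, $\dim\Lambda_S=\dim\Lambda_{\{0\}}=16$ and $\dim(\Lambda_S\cap\Lambda_{\{0\}})=15$. Moreover, the dual cone $X^\vee=\{\xi\in V^*\mid (0,\xi)\in\Lambda_S\}$ is a divisor in $V^*$, i.e. a nonempty closed subvariety all of whose irreducible components have codimension one. -/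

import Mathlib

/-! Affine space `V = ℂ^σ` is the type `σ → ℂ`.  Its dual is identified with `σ → ℂ` through the
pairing `⟨ξ, v⟩ = ∑ i, ξ i * v i`, and `T^*V = V × V^*` with `σ ⊕ σ → ℂ`, the point `(x, ξ)` being
`Sum.elim x ξ`. -/

noncomputable section

namespace Microlocal

/-- The differential at `p` of the polynomial function `f`, as a covector in coordinates. -/
def differential {σ : Type*} (f : MvPolynomial σ ℂ) (p : σ → ℂ) : σ → ℂ :=
  fun i => MvPolynomial.eval p (MvPolynomial.pderiv i f)

/-- The Zariski closure of a subset of affine space. -/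
def zariskiClosure {σ : Type*} (S : Set (σ → ℂ)) : Set (σ → ℂ) :=
  MvPolynomial.zeroLocus ℂ (MvPolynomial.vanishingIdeal ℂ S)

/-- The dimension of a subset of affine space: the Krull dimension of the ring of polynomial
functions on it (equivalently, the dimension of its Zariski closure; `⊥` for the empty set). -/
def dimension {σ : Type*} (S : Set (σ → ℂ)) : WithBot ℕ∞ :=
  ringKrullDim (MvPolynomial σ ℂ ⧸ MvPolynomial.vanishingIdeal ℂ S)

/-- `p` is a smooth point of the (reduced) variety `X`: in some Zariski neighbourhood `{h ≠ 0}` of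
`p`, the set `X` is the common zero set of finitely many polynomials whose differentials at `p` are
linearly independent. -/
def IsSmoothPoint {σ : Type*} (X : Set (σ → ℂ)) (p : σ → ℂ) : Prop :=
  p ∈ X ∧ ∃ (k : ℕ) (f : Fin k → MvPolynomial σ ℂ) (h : MvPolynomial σ ℂ),
    LinearIndependent ℂ (fun j => differential (f j) p) ∧
    MvPolynomial.eval p h ≠ 0 ∧
    ∀ x : σ → ℂ, MvPolynomial.eval x h ≠ 0 → (x ∈ X ↔ ∀ j, MvPolynomial.eval x (f j) = 0)

/-- The smooth part (smooth locus) of a variety. -/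
def smoothPart {σ : Type*} (X : Set (σ → ℂ)) : Set (σ → ℂ) :=
  {p | IsSmoothPoint X p}

/-- The tangent space `T_p S`: the vectors killed by the differentials at `p` of all polynomials
vanishing on `S`.  For a smooth locally closed subvariety `S` and `p ∈ S` this is the tangent space
of the complex manifold `S`. -/
def tangentSpace {σ : Type*} [Fintype σ] (S : Set (σ → ℂ)) (p : σ → ℂ) : Set (σ → ℂ) :=
  {v | ∀ f ∈ MvPolynomial.vanishingIdeal ℂ S, ∑ i, differential f p i * v i = 0}

/-- The conormal bundle `T^*_S V ⊆ T^*V`: the pairs `(p, ξ)` with `p ∈ S` and `ξ` vanishing on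
`T_p S`. -/
def conormalBundle {σ : Type*} [Fintype σ] (S : Set (σ → ℂ)) : Set (σ ⊕ σ → ℂ) :=
  {z | ∃ p ξ : σ → ℂ, z = Sum.elim p ξ ∧ p ∈ S ∧ ∀ v ∈ tangentSpace S p, ∑ i, ξ i * v i = 0}

/-- `Λ_S`, the closure of the conormal bundle `T^*_S V`. -/
def conormalVariety {σ : Type*} [Fintype σ] (S : Set (σ → ℂ)) : Set (σ ⊕ σ → ℂ) :=
  zariskiClosure (conormalBundle S)

/-- `S` and `T` meet microlocally in codimension one: `dim (Λ_S ∩ Λ_T) = dim Λ - 1`.  Here the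
conormal variety `Λ` of a stratification containing `S` and `T` is the union of the `Λ_R` over all
strata `R`, each of dimension `dim V`; so `dim Λ = dim Λ_S = dim Λ_T = dim V`, and all of these
equalities are demanded. -/
def MeetMicrolocallyInCodimensionOne {σ : Type*} [Fintype σ] (S T : Set (σ → ℂ)) : Prop :=
  dimension (conormalVariety S) = Fintype.card σ ∧
  dimension (conormalVariety T) = Fintype.card σ ∧
  dimension (conormalVariety S ∩ conormalVariety T) + 1 = Fintype.card σ

/-- The dual cone of the closure of the stratum `S`: `Λ_S ∩ T^*_0 V`, as a subset of `V^*`. -/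
def dualCone {σ : Type*} [Fintype σ] (S : Set (σ → ℂ)) : Set (σ → ℂ) :=
  {ξ | Sum.elim (0 : σ → ℂ) ξ ∈ conormalVariety S}

/-- `D` is a (reduced, nonzero) divisor in affine space: a nonempty Zariski closed subset all of
whose irreducible components have codimension one. -/
def IsDivisor {σ : Type*} (D : Set (σ → ℂ)) : Prop :=
  D.Nonempty ∧ zariskiClosure D = D ∧
    ∀ P ∈ (MvPolynomial.vanishingIdeal ℂ D).minimalPrimes, P.height = 1

/-- Coordinates on `Mat(2 × 2, ℂ)^4`: the index `(i, a, b)` is the entry `(a, b)` of `A_i`. -/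
abbrev Coord : Type := Fin 4 × Fin 2 × Fin 2

/-- The matrix `A_i` of a point of `Mat(2 × 2, ℂ)^4`. -/
def block (x : Coord → ℂ) (i : Fin 4) : Matrix (Fin 2) (Fin 2) ℂ :=
  Matrix.of fun a b => x (i, a, b)

/-- The variety of all `(A_0, A_1, A_2, A_3)` with `det A_i = 0` and `A_i A_{i+1} = 0` for all `i`.
Addition in `Fin 4` is modulo `4`. -/
def kashiwaraSaitoVariety : Set (Coord → ℂ) :=
  {x | ∀ i : Fin 4, (block x i).det = 0 ∧ block x i * block x (i + 1) = 0}

end Microlocal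

end

noncomputable section

namespace Microlocal

open MvPolynomial

variable {σ τ : Type*}

/-! On a dense open cell every block of a point of $X$ is $c_i(-z_{i-1},1)^T(1,z_i)$, so 8
parameters describe the cell; 8 multipliers $m,s$ describe the conormal covectors over it. Hence
$\Lambda_S$ is the closure of the image of a polynomial map from $\mathbb C^{16}$
(`conormalVariety_eq`): it is irreducible of dimension at most 16. Such a covector is a cycle of
matrices $B_i$ sending the line of $(1,z_i)$ to that of $(1,z_{i-1})$. In adapted bases $B_i$ is
triangular with diagonal $m_{i-1}c_{i-1},\ m_ic_{i+1}$. Both diagonals have the same product over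
the cycle, so $B_0B_1B_2B_3$ has a double eigenvalue and its discriminant vanishes. Conversely, an
invertible cycle with zero discriminant comes, up to a small change of basis, from the chart, and
singular cycles are limits of invertible ones. Scaling $c$ by $\varepsilon$ and $m$ by
$\varepsilon^{-1}$ fixes the covector and moves the base point to 0. So the dual cone is exactly the
discriminant hypersurface (`dualCone_eq`), of dimension 15. It is a proper closed part of the
irreducible $\Lambda_S$, which therefore has dimension 16. -/

theorem mem_zariskiClosure_iff {S : Set (σ → ℂ)} {x : σ → ℂ} :
    x ∈ zariskiClosure S ↔ ∀ f : MvPolynomial σ ℂ, (∀ y ∈ S, eval y f = 0) → eval x f = 0 := by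
  simp [zariskiClosure, aeval_eq_eval]

theorem mem_vanishingIdeal_iff_eval {S : Set (σ → ℂ)} {f : MvPolynomial σ ℂ} :
    f ∈ vanishingIdeal ℂ S ↔ ∀ y ∈ S, eval y f = 0 := by
  simp [aeval_eq_eval]

theorem subset_zariskiClosure (S : Set (σ → ℂ)) : S ⊆ zariskiClosure S :=
  zeroLocus_vanishingIdeal_le S

theorem vanishingIdeal_zariskiClosure (S : Set (σ → ℂ)) :
    vanishingIdeal ℂ (zariskiClosure S) = vanishingIdeal ℂ S :=
  le_antisymm (vanishingIdeal_anti_mono (subset_zariskiClosure S))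
    (le_vanishingIdeal_zeroLocus _)

theorem zariskiClosure_subset_iff {S T : Set (σ → ℂ)} :
    zariskiClosure S ⊆ zariskiClosure T ↔ S ⊆ zariskiClosure T :=
  ⟨(subset_zariskiClosure S).trans, fun h => zeroLocus_anti_mono
    (by rw [← vanishingIdeal_zariskiClosure T]; exact vanishingIdeal_anti_mono h)⟩

/-- Closed in the Euclidean topology: this allows limits of curves to be used to reach points of a
Zariski closure. -/
theorem isClosed_zariskiClosure (S : Set (σ → ℂ)) : IsClosed (zariskiClosure S) := by
  have : zariskiClosure S = ⋂ f ∈ vanishingIdeal ℂ S, {x | eval x f = 0} := by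
    ext x; simp [zariskiClosure, aeval_eq_eval]
  rw [this]
  exact isClosed_biInter fun f _ => isClosed_eq (MvPolynomial.continuous_eval f) continuous_const

theorem dimension_zariskiClosure (S : Set (σ → ℂ)) :
    dimension (zariskiClosure S) = dimension S := by
  rw [dimension, dimension, vanishingIdeal_zariskiClosure]

/-! ### Directional derivatives of polynomials -/

section Derivative

variable [Fintype σ]

/-- The derivative of `f` at `p` in the direction `v`. -/
def directional (f : MvPolynomial σ ℂ) (p v : σ → ℂ) : ℂ := ∑ i, differential f p i * v i

theorem directional_add (f g : MvPolynomial σ ℂ) (p v : σ → ℂ) :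
    directional (f + g) p v = directional f p v + directional g p v := by
  simp [directional, differential, add_mul, Finset.sum_add_distrib]

theorem directional_sub (f g : MvPolynomial σ ℂ) (p v : σ → ℂ) :
    directional (f - g) p v = directional f p v - directional g p v := by
  simp [directional, differential, sub_mul, Finset.sum_sub_distrib]

theorem directional_C (a : ℂ) (p v : σ → ℂ) : directional (C a) p v = 0 := by
  simp [directional, differential]

theorem directional_X (i : σ) (p v : σ → ℂ) : directional (X i) p v = v i := by
  classical
  simp [directional, differential, pderiv_X, Pi.single_apply, apply_ite, ite_mul]

theorem directional_mul (f g : MvPolynomial σ ℂ) (p v : σ → ℂ) :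
    directional (f * g) p v = directional f p v * eval p g + eval p f * directional g p v := by
  simp only [directional, differential, Derivation.leibniz, smul_eq_mul, map_add, map_mul,
    Finset.sum_mul, Finset.mul_sum, ← Finset.sum_add_distrib]
  exact Finset.sum_congr rfl fun i _ => by ring

theorem differential_eq_directional [DecidableEq σ] (f : MvPolynomial σ ℂ) (p : σ → ℂ) (i : σ) :
    differential f p i = directional f p (Pi.single i 1) := by
  simp [directional, Pi.single_apply]

theorem hasDerivAt_eval_line (f : MvPolynomial σ ℂ) (p v : σ → ℂ) :
    HasDerivAt (fun s : ℂ => eval (p + s • v) f) (directional f p v) 0 := by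
  induction f using MvPolynomial.induction_on with
  | C a => simpa [directional_C] using hasDerivAt_const (0 : ℂ) a
  | add f g hf hg => simpa only [map_add, directional_add] using hf.fun_add hg
  | mul_X f i hf =>
    have hX : HasDerivAt (fun s : ℂ => eval (p + s • v) (X i)) (v i) 0 := by
      simpa using ((hasDerivAt_id (0 : ℂ)).mul_const (v i)).const_add (p i)
    simpa [directional_mul, directional_X] using hf.fun_mul hX

/-- A polynomial that vanishes along a line has zero derivative in the direction of the line. -/
theorem directional_eq_zero {f : MvPolynomial σ ℂ} {p v : σ → ℂ}
    (h : ∀ s : ℂ, eval (p + s • v) f = 0) : directional f p v = 0 := by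
  have h₁ := hasDerivAt_eval_line f p v
  simp only [h] at h₁
  exact h₁.unique (hasDerivAt_const _ _)

theorem mem_tangentSpace_iff {S : Set (σ → ℂ)} {p v : σ → ℂ} :
    v ∈ tangentSpace S p ↔ ∀ f ∈ vanishingIdeal ℂ S, directional f p v = 0 := Iff.rfl

/-- A covector that vanishes on the tangent space is the differential of an equation. -/
theorem exists_differential_eq {S : Set (σ → ℂ)} {p ξ : σ → ℂ}
    (h : ∀ v ∈ tangentSpace S p, ∑ i, ξ i * v i = 0) :
    ∃ f ∈ vanishingIdeal ℂ S, differential f p = ξ := by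
  classical
  let d : MvPolynomial σ ℂ →ₗ[ℂ] (σ → ℂ) :=
    { toFun := fun f => differential f p
      map_add' := fun f g => by ext i; simp [differential]
      map_smul' := fun a f => by ext i; simp [differential] }
  let W : Submodule ℂ (σ → ℂ) := ((vanishingIdeal ℂ S).restrictScalars ℂ).map d
  suffices hξ : ξ ∈ W by
    obtain ⟨f, hf, hfξ⟩ := hξ
    exact ⟨f, hf, hfξ⟩
  by_contra hξ
  -- A functional on covectors is a vector; one that kills all differentials of equations is
  -- tangent, so it must kill `ξ` too.
  obtain ⟨φ, hφ, hφW⟩ := Submodule.exists_le_ker_of_notMem hξ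
  have hφ' (η : σ → ℂ) : φ η = ∑ i, η i * φ (Pi.single i 1) := by
    conv_lhs => rw [pi_eq_sum_univ' η]
    simp only [map_sum, map_smul, smul_eq_mul]
  refine hφ ?_
  rw [hφ' ξ]
  refine h _ fun f hf => ?_
  rw [← hφ' (differential f p)]
  exact hφW ⟨f, hf, rfl⟩

end Derivative

/-! ### Dimension -/

/-- Incomparability: along an integral map, strict inclusions of primes stay strict after
contraction. -/
theorem ringKrullDim_le_of_isIntegral {R S : Type*} [CommRing R] [CommRing S] (f : R →+* S)
    (hf : f.IsIntegral) : ringKrullDim S ≤ ringKrullDim R := by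
  algebraize [f]
  refine Order.krullDim_le_of_strictMono
    (fun P : PrimeSpectrum S => (PrimeSpectrum.comap (algebraMap R S) P)) fun P Q h => ?_
  obtain ⟨x, hx, hx'⟩ := SetLike.exists_of_lt (PrimeSpectrum.asIdeal_lt_asIdeal _ _ |>.2 h)
  exact Ideal.comap_lt_comap_of_integral_mem_sdiff h.le ⟨hx, hx'⟩
    (Algebra.IsIntegral.isIntegral x)

/-- The Krull dimension of a finitely generated subalgebra of a polynomial ring. -/
theorem ringKrullDim_le_of_injective {k A : Type*} [Field k] [CommRing A] [Algebra k A]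
    [Algebra.FiniteType k A] [Fintype τ] (φ : A →ₐ[k] MvPolynomial τ k)
    (hφ : Function.Injective φ) : ringKrullDim A ≤ Fintype.card τ := by
  have : Nontrivial A := φ.toRingHom.domain_nontrivial
  -- Noether normalization; `n` is bounded by comparing transcendence degrees.
  obtain ⟨n, g, hg, hgi⟩ := exists_integral_inj_algHom_of_fg k A
  have h := lift_trdeg_le_of_injective (φ.comp g) (hφ.comp hg)
  rw [MvPolynomial.trdeg_of_isDomain, MvPolynomial.trdeg_of_isDomain] at h
  have hn : n ≤ Fintype.card τ := by simpa using h
  refine (ringKrullDim_le_of_isIntegral g.toRingHom hgi).trans ?_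
  rw [MvPolynomial.ringKrullDim_of_isNoetherianRing, ringKrullDim_eq_zero_of_field]
  simpa using hn

theorem vanishingIdeal_range (Φ : σ → MvPolynomial τ ℂ) :
    vanishingIdeal ℂ (Set.range fun t : τ → ℂ => fun i => eval t (Φ i)) =
      RingHom.ker (aeval (R := ℂ) Φ) := by
  ext f
  rw [mem_vanishingIdeal_iff_eval, Set.forall_mem_range, RingHom.mem_ker]
  have h (t : τ → ℂ) : eval (fun i => eval t (Φ i)) f = eval t (aeval Φ f) := by
    rw [← aeval_eq_eval, ← aeval_eq_eval, ← AlgHom.comp_apply, comp_aeval]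
  simp only [h]
  exact ⟨fun h' => MvPolynomial.funext (by simpa using h'), fun h' t => by rw [h', map_zero]⟩

theorem isPrime_vanishingIdeal_range (Φ : σ → MvPolynomial τ ℂ) :
    (vanishingIdeal ℂ (Set.range fun t : τ → ℂ => fun i => eval t (Φ i))).IsPrime := by
  rw [vanishingIdeal_range]; exact RingHom.ker_isPrime _

/-- The image of a polynomial map has at most the dimension of its source. -/
theorem dimension_range_le [Finite σ] [Fintype τ] (Φ : σ → MvPolynomial τ ℂ) :
    dimension (Set.range fun t : τ → ℂ => fun i => eval t (Φ i)) ≤ Fintype.card τ := by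
  rw [dimension, vanishingIdeal_range]
  exact ringKrullDim_le_of_injective (Ideal.kerLiftAlg (aeval (R := ℂ) Φ))
    (Ideal.kerLiftAlg_injective _)

/-- A proper closed subset of an irreducible variety has smaller dimension. -/
theorem dimension_succ_le {S T : Set (σ → ℂ)} (hST : T ⊆ S) (hS : (vanishingIdeal ℂ S).IsPrime)
    {f : MvPolynomial σ ℂ} (hf : f ∈ vanishingIdeal ℂ T) (hf' : f ∉ vanishingIdeal ℂ S) :
    dimension T + 1 ≤ dimension S := by
  refine ringKrullDim_succ_le_of_surjective
    (Ideal.Quotient.factor (vanishingIdeal_anti_mono hST))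
    (Ideal.Quotient.factor_surjective _) (r := Ideal.Quotient.mk _ f) ?_ ?_
  · rw [mem_nonZeroDivisors_iff_ne_zero]
    rwa [Ne, Ideal.Quotient.eq_zero_iff_mem]
  · rw [Ideal.Quotient.factor_mk]
    exact Ideal.Quotient.eq_zero_iff_mem.2 hf

/-- The points of the zero section over `D` have the dimension of `D`. -/
theorem dimension_zeroSection (D : Set (σ → ℂ)) :
    dimension ((fun ξ : σ → ℂ => Sum.elim (0 : σ → ℂ) ξ) '' D) = dimension D := by
  let ρ : MvPolynomial (σ ⊕ σ) ℂ →ₐ[ℂ] MvPolynomial σ ℂ := aeval (Sum.elim 0 X)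
  have hρ (f : MvPolynomial (σ ⊕ σ) ℂ) (ξ : σ → ℂ) :
      eval ξ (ρ f) = eval (Sum.elim (0 : σ → ℂ) ξ) f := by
    rw [← aeval_eq_eval, ← aeval_eq_eval, ← AlgHom.comp_apply, comp_aeval]
    congr 2
    ext i
    rcases i with i | i <;> simp
  have hsurj : Function.Surjective ρ := fun g =>
    ⟨rename Sum.inr g, by rw [aeval_rename, Sum.elim_comp_inr, aeval_X_left_apply]⟩
  have hker : RingHom.ker ((Ideal.Quotient.mk (vanishingIdeal ℂ D)).comp ρ.toRingHom) =
      vanishingIdeal ℂ ((fun ξ : σ → ℂ => Sum.elim (0 : σ → ℂ) ξ) '' D) := by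
    ext f
    rw [RingHom.mem_ker, RingHom.comp_apply, Ideal.Quotient.eq_zero_iff_mem,
      mem_vanishingIdeal_iff_eval, mem_vanishingIdeal_iff_eval, Set.forall_mem_image]
    exact forall₂_congr fun ξ _ => by rw [← hρ]; rfl
  rw [dimension, dimension, ← hker]
  exact ringKrullDim_eq_of_ringEquiv (RingHom.quotientKerEquivOfSurjective
    (Ideal.Quotient.mk_surjective.comp hsurj))

/-! ### Hypersurfaces -/

section Hypersurface

/-- Translations are automorphisms, so all points have the same height. By the Nullstellensatz the
points are all the maximal ideals, and their heights compute the Krull dimension. -/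
theorem height_vanishingIdeal_singleton [Fintype σ] (a : σ → ℂ) :
    (vanishingIdeal ℂ {a} : Ideal (MvPolynomial σ ℂ)).height = Fintype.card σ := by
  have hmove (a b : σ → ℂ) : (vanishingIdeal ℂ {a} : Ideal (MvPolynomial σ ℂ)).height =
      (vanishingIdeal ℂ {b} : Ideal (MvPolynomial σ ℂ)).height := by
    let e : MvPolynomial σ ℂ ≃ₐ[ℂ] MvPolynomial σ ℂ :=
      AlgEquiv.ofAlgHom (aeval fun i => X i + C (b i - a i)) (aeval fun i => X i - C (b i - a i))
        (by ext i; simp) (by ext i; simp)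
    have he : vanishingIdeal ℂ {b} = (vanishingIdeal ℂ {a}).comap (e : _ ≃+* _) := by
      ext f
      rw [Ideal.mem_comap, mem_vanishingIdeal_iff_eval, mem_vanishingIdeal_iff_eval]
      have : eval a (e f) = eval b f := by
        change eval a (aeval (fun i => X i + C (b i - a i)) f) = _
        rw [← aeval_eq_eval, ← aeval_eq_eval, ← AlgHom.comp_apply, comp_aeval]
        congr 2
        ext i
        simp
      simp only [Set.mem_singleton_iff, forall_eq]
      exact iff_of_eq (by rw [← this]; rfl)
    rw [he, RingEquiv.height_comap]
  have hdim : ringKrullDim (MvPolynomial σ ℂ) = Fintype.card σ := by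
    rw [MvPolynomial.ringKrullDim_of_isNoetherianRing, ringKrullDim_eq_zero_of_field]
    simp
  apply le_antisymm
  · have := Ideal.height_le_ringKrullDim_of_isPrime (I := vanishingIdeal ℂ {a})
    rw [hdim] at this
    exact_mod_cast this
  · have : ringKrullDim (MvPolynomial σ ℂ) ≤
        (vanishingIdeal ℂ {a} : Ideal (MvPolynomial σ ℂ)).height := by
      rw [ringKrullDim_le_iff_isMaximal_height_le]
      intro m hm
      obtain ⟨b, rfl⟩ := isMaximal_iff_eq_vanishingIdeal_singleton.1 hm
      rw [hmove b a]
    rw [hdim] at this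
    exact_mod_cast this

theorem vanishingIdeal_hypersurface [Finite σ] (f : MvPolynomial σ ℂ) :
    vanishingIdeal ℂ {x : σ → ℂ | eval x f = 0} = (Ideal.span {f}).radical := by
  rw [← vanishingIdeal_zeroLocus_eq_radical (K := ℂ), zeroLocus_span]
  simp [aeval_eq_eval]

/-- A nonzerodivisor lowers the dimension by at least one; at the point `a`, whose ideal has full
height, one equation lowers it by at most one. -/
theorem dimension_hypersurface [Fintype σ] {f : MvPolynomial σ ℂ} (hf : f ≠ 0) {a : σ → ℂ}
    (ha : eval a f = 0) : dimension {x : σ → ℂ | eval x f = 0} + 1 = Fintype.card σ := by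
  have hrad : dimension {x : σ → ℂ | eval x f = 0} =
      ringKrullDim (MvPolynomial σ ℂ ⧸ Ideal.span {f}) := by
    rw [dimension, vanishingIdeal_hypersurface, ringKrullDim_quotient, ringKrullDim_quotient,
      PrimeSpectrum.zeroLocus_radical]
  have hdim : ringKrullDim (MvPolynomial σ ℂ) = Fintype.card σ := by
    rw [MvPolynomial.ringKrullDim_of_isNoetherianRing, ringKrullDim_eq_zero_of_field]
    simp
  rw [hrad]
  apply le_antisymm
  · rw [← hdim]
    exact ringKrullDim_quotient_succ_le_of_nonZeroDivisor (mem_nonZeroDivisors_of_ne_zero hf)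
  · have h := Ideal.height_le_ringKrullDim_quotient_add_one (r := f) (p := vanishingIdeal ℂ {a})
      (by simpa [aeval_eq_eval] using ha)
    rw [height_vanishingIdeal_singleton] at h
    exact_mod_cast h

theorem isDivisor_hypersurface [Finite σ] {f : MvPolynomial σ ℂ} (hf : f ≠ 0) {a : σ → ℂ}
    (ha : eval a f = 0) : IsDivisor {x : σ → ℂ | eval x f = 0} := by
  refine ⟨⟨a, ha⟩, ?_, fun P hP => ?_⟩
  · refine (subset_zariskiClosure _).antisymm' fun x hx => ?_
    exact mem_zariskiClosure_iff.1 hx f fun y hy => hy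
  · rw [vanishingIdeal_hypersurface, Ideal.radical_minimalPrimes] at hP
    refine le_antisymm (Ideal.height_le_one_of_isPrincipal_of_mem_minimalPrimes _ P hP) ?_
    exact (Ideal.one_le_height_span_singleton_of_mem_nonZeroDivisors
      (mem_nonZeroDivisors_of_ne_zero hf)).trans (Ideal.height_mono hP.1.2)

end Hypersurface

theorem mem_variety_iff {x : Coord → ℂ} : x ∈ kashiwaraSaitoVariety ↔
    ∀ i : Fin 4, x (i, 0, 0) * x (i, 1, 1) - x (i, 0, 1) * x (i, 1, 0) = 0 ∧
      ∀ a b : Fin 2, x (i, a, 0) * x (i + 1, 0, b) + x (i, a, 1) * x (i + 1, 1, b) = 0 := by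
  refine forall_congr' fun i => and_congr (by rw [Matrix.det_fin_two]; rfl) ?_
  rw [← Matrix.ext_iff]
  simp [Matrix.mul_apply, block]

/-! ### The conormal parametrization -/

section Parametrization

variable {R : Type*} [CommRing R]

/-- The point with blocks `cᵢ (-zᵢ₋₁, 1)ᵀ (1, zᵢ)`. -/
def chart (z c : Fin 4 → R) : Coord → R :=
  fun p => c p.1 * ![-z (p.1 - 1), 1] p.2.1 * ![1, z p.1] p.2.2

/-- A covector conormal to the variety at `chart z c`. -/
def conormalChart (z c m s : Fin 4 → R) : Coord → R := fun p =>
  !![s p.1 * z p.1 + m (p.1 - 1) * c (p.1 - 1), -s p.1;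
    s p.1 * z (p.1 - 1) * z p.1 - m p.1 * c (p.1 + 1) * z p.1 +
      m (p.1 - 1) * c (p.1 - 1) * z (p.1 - 1),
    -s p.1 * z (p.1 - 1) + m p.1 * c (p.1 + 1)] p.2.1 p.2.2

/-- The chart of the conormal variety, with the four quadruples of parameters in one tuple. -/
def bundleChart (t : Fin 4 × Fin 4 → R) : Coord ⊕ Coord → R :=
  Sum.elim (chart (fun i => t (0, i)) fun i => t (1, i))
    (conormalChart (fun i => t (0, i)) (fun i => t (1, i)) (fun i => t (2, i)) fun i => t (3, i))

theorem map_bundleChart {S : Type*} [CommRing S] (f : R →+* S) (t : Fin 4 × Fin 4 → R) (j) :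
    f (bundleChart t j) = bundleChart (fun k => f (t k)) j := by
  rcases j with ⟨i, a, b⟩ | ⟨i, a, b⟩ <;> fin_cases a <;> fin_cases b <;>
    simp [bundleChart, chart, conormalChart]

end Parametrization

theorem range_bundleChart : Set.range (bundleChart (R := ℂ)) =
    Set.range fun t : Fin 4 × Fin 4 → ℂ => fun j => eval t (bundleChart X j) := by
  congr 1
  ext t j
  rw [map_bundleChart]
  simp

theorem chart_mem (z c : Fin 4 → ℂ) : chart z c ∈ kashiwaraSaitoVariety := by
  rw [mem_variety_iff]
  refine fun i => ⟨by simp [chart]; ring, fun a b => ?_⟩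
  simp only [chart, add_sub_cancel_right]
  fin_cases a <;> fin_cases b <;> simp <;> ring

/-! ### The big cell and its smoothness -/

/-- The part of the variety where no block has a vanishing lower left entry. -/
def bigCell : Set (Coord → ℂ) := {x | x ∈ kashiwaraSaitoVariety ∧ ∀ i, x (i, 1, 0) ≠ 0}

theorem chart_mem_bigCell {z c : Fin 4 → ℂ} (hc : ∀ i, c i ≠ 0) : chart z c ∈ bigCell :=
  ⟨chart_mem z c, fun i => by simpa [chart] using hc i⟩

/-- Off the zeros of the lower left entries, these eight equations already cut out the variety: they
determine the upper row of each block. -/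
theorem eq_chart_of_equations {x : Coord → ℂ} (hx : ∀ i, x (i, 1, 0) ≠ 0)
    (hdet : ∀ i, x (i, 0, 0) * x (i, 1, 1) - x (i, 0, 1) * x (i, 1, 0) = 0)
    (hmul : ∀ i, x (i, 1, 0) * x (i + 1, 0, 0) + x (i, 1, 1) * x (i + 1, 1, 0) = 0) :
    x = chart (fun i => x (i, 1, 1) / x (i, 1, 0)) fun i => x (i, 1, 0) := by
  have h00 (i : Fin 4) : x (i, 0, 0) = x (i, 1, 0) * -(x (i - 1, 1, 1) / x (i - 1, 1, 0)) := by
    have h := hmul (i - 1)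
    rw [sub_add_cancel] at h
    have := hx (i - 1)
    field_simp
    linear_combination h
  have h01 (i : Fin 4) : x (i, 0, 1) = x (i, 0, 0) * (x (i, 1, 1) / x (i, 1, 0)) := by
    have := hx i
    field_simp
    linear_combination -hdet i
  ext ⟨i, a, b⟩
  have := hx i
  fin_cases a <;> fin_cases b <;> simp only [chart] <;> simp
  · rw [h00]; ring
  · rw [h01, h00]; ring
  · field_simp

/-- The determinant of the block `Aᵢ`. -/
def detEquation (i : Fin 4) : MvPolynomial Coord ℂ :=
  X (i, 0, 0) * X (i, 1, 1) - X (i, 0, 1) * X (i, 1, 0)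

/-- The lower left entry of `Aᵢ Aᵢ₊₁`. -/
def mulEquation (i : Fin 4) : MvPolynomial Coord ℂ :=
  X (i, 1, 0) * X (i + 1, 0, 0) + X (i, 1, 1) * X (i + 1, 1, 0)

theorem directional_detEquation (i : Fin 4) (x v : Coord → ℂ) :
    directional (detEquation i) x v = v (i, 0, 0) * x (i, 1, 1) + x (i, 0, 0) * v (i, 1, 1) -
      (v (i, 0, 1) * x (i, 1, 0) + x (i, 0, 1) * v (i, 1, 0)) := by
  simp [detEquation, directional_sub, directional_mul, directional_X]

theorem directional_mulEquation (i : Fin 4) (x v : Coord → ℂ) :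
    directional (mulEquation i) x v =
      v (i, 1, 0) * x (i + 1, 0, 0) + x (i, 1, 0) * v (i + 1, 0, 0) +
      (v (i, 1, 1) * x (i + 1, 1, 0) + x (i, 1, 1) * v (i + 1, 1, 0)) := by
  simp [mulEquation, directional_add, directional_mul, directional_X]

theorem bigCell_subset_smoothPart : bigCell ⊆ smoothPart kashiwaraSaitoVariety := by
  intro x hx
  let e : Fin 8 ≃ Fin 4 ⊕ Fin 4 := (finSumFinEquiv (m := 4) (n := 4)).symm
  let f : Fin 4 ⊕ Fin 4 → MvPolynomial Coord ℂ := Sum.elim detEquation mulEquation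
  refine ⟨hx.1, 8, f ∘ e, ∏ i, X (i, 1, 0), ?_, ?_, fun y hy => ⟨fun h j => ?_, fun h => ?_⟩⟩
  · have hli : LinearIndependent ℂ fun j => differential (f j) x := by
      rw [Fintype.linearIndependent_iff]
      intro g hg
      have hg' (p : Coord) : ∑ i, g (Sum.inl i) * directional (detEquation i) x (Pi.single p 1) +
          ∑ i, g (Sum.inr i) * directional (mulEquation i) x (Pi.single p 1) = 0 := by
        have := congrFun hg p
        simpa [Fintype.sum_sum_type, f, differential_eq_directional] using this
      -- The Jacobian is triangular: the entry `(i, 0, 1)` occurs only in the `i`-th determinant,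
      -- and `(i, 1, 1)` only in the `i`-th product equation once the determinants are discarded.
      have hdet (i : Fin 4) : g (Sum.inl i) = 0 := by
        have := hg' (i, 0, 1)
        simp only [directional_detEquation, directional_mulEquation] at this
        simpa [Pi.single_apply, hx.2 i] using this
      have hmul (i : Fin 4) : g (Sum.inr i) = 0 := by
        have := hg' (i, 1, 1)
        simp only [directional_detEquation, directional_mulEquation] at this
        simpa [Pi.single_apply, hx.2 (i + 1), hdet] using this
      rintro (i | i)
      exacts [hdet i, hmul i]
    exact hli.comp e e.injective
  · simpa [map_prod, Finset.prod_eq_zero_iff] using hx.2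
  · change eval y (f (e j)) = 0
    rw [mem_variety_iff] at h
    rcases e j with i | i
    · simpa [f, detEquation] using (h i).1
    · simpa [f, mulEquation] using (h i).2 1 0
  · have hf (j : Fin 4 ⊕ Fin 4) : eval y (f j) = 0 := by
      simpa using h (e.symm j)
    rw [eq_chart_of_equations (x := y) (by simpa [map_prod, Finset.prod_eq_zero_iff] using hy)
      (fun i => by simpa [f, detEquation] using hf (Sum.inl i))
      (fun i => by simpa [f, mulEquation] using hf (Sum.inr i))]
    exact chart_mem _ _

theorem smoothPart_subset {σ : Type*} (S : Set (σ → ℂ)) : smoothPart S ⊆ S := fun _ h => h.1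

theorem continuous_bundleChart : Continuous (bundleChart (R := ℂ)) := by
  refine continuous_pi fun j => ?_
  have (t : Fin 4 × Fin 4 → ℂ) : bundleChart t j = eval t (bundleChart X j) := by
    rw [map_bundleChart]
    simp
  simp only [this]
  exact MvPolynomial.continuous_eval _

theorem eventually_add_ne_zero (a : ℂ) : ∀ᶠ s : ℂ in nhdsWithin 0 {0}ᶜ, a + s ≠ 0 := by
  by_cases ha : a = 0
  · filter_upwards [self_mem_nhdsWithin] with s hs
    simpa [ha] using hs
  · have : Filter.Tendsto (fun s : ℂ => a + s) (nhdsWithin 0 {0}ᶜ) (nhds (a + 0)) :=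
      ((continuous_const.add continuous_id).tendsto 0).mono_left nhdsWithin_le_nhds
    exact this.eventually_ne (by simpa using ha)

/-! ### Density of the big cell -/

/-- Two singular matrices with product zero share a line: it contains the image of the second
and is killed by the first. -/
theorem exists_line {A B : Matrix (Fin 2) (Fin 2) ℂ} (hA : A.det = 0) (hB : B.det = 0)
    (hAB : A * B = 0) :
    ∃ v : Fin 2 → ℂ, v ≠ 0 ∧ A.mulVec v = 0 ∧ ∀ b, v 0 * B 1 b = v 1 * B 0 b := by
  by_cases h : B = 0
  · obtain ⟨v, hv, hAv⟩ := Matrix.exists_mulVec_eq_zero_iff.2 hA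
    exact ⟨v, hv, hAv, by simp [h]⟩
  · obtain ⟨b, hb⟩ : ∃ b, B.col b ≠ 0 := by
      by_contra! h'
      exact h (by ext i j; exact congrFun (h' j) i)
    refine ⟨B.col b, hb, ?_, fun b' => ?_⟩
    · ext i
      exact congrFun (congrFun hAB i) b
    · rw [Matrix.det_fin_two] at hB
      fin_cases b <;> fin_cases b' <;> simp [Matrix.col] <;>
        first | exact mul_comm _ _ | linear_combination hB | linear_combination -hB

/-- Shared lines spanned by `v i` give $A_i=c_i\,v_{i-1}(v_{i,1},-v_{i,0})$, even at degenerate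
points. Replacing $c_i$ by $c_i+s$ and $v_{i,1}$ by $v_{i,1}+s$ stays in the variety and makes every
lower left entry nonzero for small $s\neq0$. -/
theorem variety_subset_closure_bigCell : kashiwaraSaitoVariety ⊆ closure bigCell := by
  intro x hx
  choose v hv hker him using fun i => exists_line (hx i).1 (hx (i + 1)).1 (hx i).2
  have hker' (i : Fin 4) (a : Fin 2) : x (i, a, 0) * v i 0 + x (i, a, 1) * v i 1 = 0 := by
    simpa [Matrix.mulVec, dotProduct, block] using congrFun (hker i) a
  have him' (i : Fin 4) (b : Fin 2) : v (i - 1) 0 * x (i, 1, b) = v (i - 1) 1 * x (i, 0, b) := by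
    simpa [block] using him (i - 1) b
  have hc (i : Fin 4) : ∃ c : ℂ, ∀ a, x (i, a, 0) = c * v (i - 1) a * v i 1 ∧
      x (i, a, 1) = -c * v (i - 1) a * v i 0 := by
    have hr (a : Fin 2) : ∃ r : ℂ, x (i, a, 0) = r * v i 1 ∧ x (i, a, 1) = -r * v i 0 := by
      by_cases h0 : v i 0 = 0
      · have h1 : v i 1 ≠ 0 := fun h1 => hv i (by ext k; fin_cases k <;> simp [h0, h1])
        have := hker' i a
        refine ⟨x (i, a, 0) / v i 1, by field_simp, ?_⟩
        simpa [h0, h1] using this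
      · refine ⟨-x (i, a, 1) / v i 0, ?_, by field_simp⟩
        have := hker' i a
        field_simp
        linear_combination this
    choose r hr₀ hr₁ using hr
    have hr' : v (i - 1) 0 * r 1 = v (i - 1) 1 * r 0 := by
      by_cases h0 : v i 0 = 0
      · have h1 : v i 1 ≠ 0 := fun h1 => hv i (by ext k; fin_cases k <;> simp [h0, h1])
        have := him' i 0
        rw [hr₀, hr₀] at this
        exact mul_right_cancel₀ h1 (by linear_combination this)
      · have := him' i 1
        rw [hr₁, hr₁] at this
        exact mul_right_cancel₀ h0 (by linear_combination -this)
    obtain ⟨c, hc⟩ : ∃ c : ℂ, ∀ a, r a = c * v (i - 1) a := by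
      by_cases h0 : v (i - 1) 0 = 0
      · have h1 : v (i - 1) 1 ≠ 0 := fun h1 =>
          hv (i - 1) (by ext k; fin_cases k <;> simp [h0, h1])
        refine ⟨r 1 / v (i - 1) 1, fun a => ?_⟩
        have h2 : r 0 = 0 := by simpa [h0, h1] using hr'
        fin_cases a
        · simp [h0, h2]
        · simp; field_simp
      · refine ⟨r 0 / v (i - 1) 0, fun a => ?_⟩
        fin_cases a
        · simp; field_simp
        · simp; field_simp; linear_combination hr'
    exact ⟨c, fun a => ⟨by rw [hr₀, hc], by rw [hr₁, hc]; ring⟩⟩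
  choose c hc using hc
  let γ : ℂ → Coord → ℂ := fun s p =>
    (c p.1 + s) * (v (p.1 - 1) p.2.1 + s * ![0, 1] p.2.1) * ![v p.1 1 + s, -v p.1 0] p.2.2
  have hγ₀ : γ 0 = x := by
    ext ⟨i, a, b⟩
    fin_cases b
    · simp [γ, (hc i a).1]
    · simp [γ, (hc i a).2]
  have hγ : Continuous γ := by
    refine continuous_pi fun ⟨i, a, b⟩ => ?_
    fin_cases b <;> simp [γ] <;> fun_prop
  have hmem (s : ℂ) : γ s ∈ kashiwaraSaitoVariety := by
    rw [mem_variety_iff]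
    refine fun i => ⟨by simp [γ]; ring, fun a b => ?_⟩
    simp only [γ, add_sub_cancel_right]
    simp
    ring
  rw [← hγ₀]
  refine mem_closure_of_tendsto ((hγ.tendsto 0).mono_left nhdsWithin_le_nhds)
    (b := nhdsWithin 0 {0}ᶜ) ?_
  filter_upwards [Filter.eventually_all.2 fun i => eventually_add_ne_zero (c i),
    Filter.eventually_all.2 fun i => eventually_add_ne_zero (v i 1)] with s h₁ h₂
  refine ⟨hmem s, fun i => ?_⟩
  simp [γ, h₁, h₂]

theorem vanishingIdeal_eq_of_bigCell_subset {S : Set (Coord → ℂ)} (h : bigCell ⊆ S)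
    (h' : S ⊆ kashiwaraSaitoVariety) :
    vanishingIdeal ℂ S = vanishingIdeal ℂ kashiwaraSaitoVariety := by
  refine le_antisymm ((vanishingIdeal_anti_mono h).trans ?_) (vanishingIdeal_anti_mono h')
  rw [← vanishingIdeal_zariskiClosure bigCell]
  exact vanishingIdeal_anti_mono (variety_subset_closure_bigCell.trans
    (closure_minimal (subset_zariskiClosure _) (isClosed_zariskiClosure _)))

/-! ### The conormal variety is the closure of the chart -/

/-- The parameters are Lagrange multipliers: `s i` for the determinant equation divided by `c i`,
and `m i` for the product equation. -/
theorem conormalChart_mem_conormalBundle {z c m s : Fin 4 → ℂ} (hc : ∀ i, c i ≠ 0) :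
    Sum.elim (chart z c) (conormalChart z c m s) ∈
      conormalBundle (smoothPart kashiwaraSaitoVariety) := by
  refine ⟨_, _, rfl, bigCell_subset_smoothPart (chart_mem_bigCell hc), fun v hv => ?_⟩
  rw [mem_tangentSpace_iff] at hv
  have hdet (i : Fin 4) := hv (detEquation i) (mem_vanishingIdeal_iff_eval.2 fun y hy => by
    simpa [detEquation] using (mem_variety_iff.1 (smoothPart_subset _ hy) i).1)
  have hmul (i : Fin 4) := hv (mulEquation i) (mem_vanishingIdeal_iff_eval.2 fun y hy => by
    simpa [mulEquation] using (mem_variety_iff.1 (smoothPart_subset _ hy) i).2 1 0)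
  have hdet' (i : Fin 4) : z i * v (i, 0, 0) - z (i - 1) * v (i, 1, 1) - v (i, 0, 1) +
      z (i - 1) * z i * v (i, 1, 0) = 0 := by
    have := hdet i
    rw [directional_detEquation] at this
    simp [chart] at this
    exact mul_left_cancel₀ (hc i) (by linear_combination this)
  have hmul' (i : Fin 4) : -c (i + 1) * z i * v (i, 1, 0) + c i * v (i + 1, 0, 0) +
      c (i + 1) * v (i, 1, 1) + c i * z i * v (i + 1, 1, 0) = 0 := by
    have := hmul i
    rw [directional_mulEquation] at this
    simp [chart] at this
    linear_combination this
  have hsum : ∑ i, (s i * (z i * v (i, 0, 0) - z (i - 1) * v (i, 1, 1) - v (i, 0, 1) +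
      z (i - 1) * z i * v (i, 1, 0)) + m i * (-c (i + 1) * z i * v (i, 1, 0) +
      c i * v (i + 1, 0, 0) + c (i + 1) * v (i, 1, 1) + c i * z i * v (i + 1, 1, 0))) = 0 := by
    simp only [hdet', hmul', mul_zero, add_zero, Finset.sum_const_zero]
  -- The product equation of index `i` also involves block `i + 1`; a cyclic shift collects these
  -- terms by block.
  have hshift := Equiv.sum_comp (Equiv.addRight (1 : Fin 4)) fun i : Fin 4 =>
    m (i - 1) * c (i - 1) * (v (i, 0, 0) + z (i - 1) * v (i, 1, 0))
  simp only [Equiv.coe_addRight, add_sub_cancel_right] at hshift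
  rw [← hsum]
  simp only [Fintype.sum_prod_type, Fin.sum_univ_two, conormalChart]
  rw [← sub_eq_zero, ← Finset.sum_sub_distrib, ← sub_eq_zero.2 hshift.symm,
    ← Finset.sum_sub_distrib]
  refine Finset.sum_congr rfl fun i _ => ?_
  simp
  ring

/-- The chart is affine in each `c i` and in each `z i` separately, so these parameters give
straight lines inside the variety, along which its equations have zero derivative. -/
theorem chart_add_smul (z c : Fin 4 → ℂ) (i : Fin 4) (s : ℂ) :
    chart z c + s • (fun p => if p.1 = i then chart z 1 p else 0) =
      chart z (Function.update c i (c i + s)) := by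
  ext ⟨j, a, b⟩
  by_cases h : j = i
  · subst h
    simp [chart]; ring
  · simp [chart, h]

theorem chart_add_smul' (z c : Fin 4 → ℂ) (i : Fin 4) (s : ℂ) :
    chart z c + s • (fun p => if p.1 = i then c i * ![-z (i - 1), 1] p.2.1 * ![0, 1] p.2.2 else
      if p.1 = i + 1 then c (i + 1) * ![-1, 0] p.2.1 * ![1, z (i + 1)] p.2.2 else 0) =
      chart (Function.update z i (z i + s)) c := by
  ext ⟨j, a, b⟩
  by_cases h : j = i
  · subst h
    have : j - 1 ≠ j := by simp
    fin_cases a <;> fin_cases b <;> simp [chart, this] <;> ring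
  · by_cases h' : j = i + 1
    · subst h'
      fin_cases a <;> fin_cases b <;> simp [chart] <;> ring
    · have : j - 1 ≠ i := fun h'' => h' (by rw [← h'', sub_add_cancel])
      simp [chart, h, h', this]

/-- At a point of the big cell every covector conormal to the variety is in the chart. -/
theorem exists_conormalChart_eq {z c : Fin 4 → ℂ} (hc : ∀ i, c i ≠ 0)
    {f : MvPolynomial Coord ℂ} (hf : f ∈ vanishingIdeal ℂ kashiwaraSaitoVariety) :
    ∃ m s : Fin 4 → ℂ, differential f (chart z c) = conormalChart z c m s := by
  rw [mem_vanishingIdeal_iff_eval] at hf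
  set ξ := differential f (chart z c) with hξ
  have h₁ (i : Fin 4) : -z (i - 1) * ξ (i, 0, 0) - z (i - 1) * z i * ξ (i, 0, 1) + ξ (i, 1, 0) +
      z i * ξ (i, 1, 1) = 0 := by
    have := directional_eq_zero (f := f) (p := chart z c)
      (v := fun p => if p.1 = i then chart z 1 p else 0)
      fun s => by rw [chart_add_smul]; exact hf _ (chart_mem _ _)
    simp only [directional, Fintype.sum_prod_type, Fin.sum_univ_two, ← hξ] at this
    simp [chart, ite_add_ite] at this
    linear_combination this
  have h₂ (i : Fin 4) : c i * (-z (i - 1) * ξ (i, 0, 1) + ξ (i, 1, 1)) =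
      c (i + 1) * (ξ (i + 1, 0, 0) + z (i + 1) * ξ (i + 1, 0, 1)) := by
    have := directional_eq_zero (f := f) (p := chart z c) fun s => by
      rw [chart_add_smul' z c i]; exact hf _ (chart_mem _ _)
    simp only [directional, Fintype.sum_prod_type, Fin.sum_univ_two, ← hξ] at this
    rw [Finset.sum_eq_add i (i + 1) (by simp) (by simp +contextual) (by simp) (by simp)] at this
    simp at this
    linear_combination this
  -- The right column of each block dictates `m` and `s`; the left column then agrees by `h₁` and
  -- `h₂`.
  refine ⟨fun i => (ξ (i, 1, 1) - z (i - 1) * ξ (i, 0, 1)) / c (i + 1),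
    fun i => -ξ (i, 0, 1), ?_⟩
  ext ⟨i, a, b⟩
  have h₃ := h₂ (i - 1)
  rw [sub_add_cancel] at h₃
  have h₄ : (ξ (i - 1, 1, 1) - z (i - 1 - 1) * ξ (i - 1, 0, 1)) / c i * c (i - 1) =
      ξ (i, 0, 0) + z i * ξ (i, 0, 1) := by
    have := hc i
    field_simp
    linear_combination h₃
  have h₅ : (ξ (i, 1, 1) - z (i - 1) * ξ (i, 0, 1)) / c (i + 1) * c (i + 1) =
      ξ (i, 1, 1) - z (i - 1) * ξ (i, 0, 1) := div_mul_cancel₀ _ (hc _)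
  fin_cases a <;> fin_cases b <;> simp [conormalChart, h₄, h₅]
  · ring
  · linear_combination h₁ i
  · ring

/-- A covector conormal at any smooth point is the differential of some `f` in the ideal of the
variety. If `F` vanishes on the chart, then $x\mapsto F(x,df_x)$ vanishes on the big cell, hence by
density at every point of the variety. Conversely, chart points with some `c i = 0` are limits of
conormal covectors over the cell. -/
theorem conormalVariety_eq : conormalVariety (smoothPart kashiwaraSaitoVariety) =
    zariskiClosure (Set.range (bundleChart (R := ℂ))) := by
  apply Set.Subset.antisymm
  · refine zariskiClosure_subset_iff.2 ?_
    rintro _ ⟨p, ξ, rfl, hp, hξ⟩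
    obtain ⟨f, hf, rfl⟩ := exists_differential_eq hξ
    rw [vanishingIdeal_eq_of_bigCell_subset bigCell_subset_smoothPart (smoothPart_subset _)] at hf
    rw [mem_zariskiClosure_iff]
    intro F hF
    let ρ : MvPolynomial Coord ℂ := aeval (Sum.elim X fun j => pderiv j f) F
    have hρ (x : Coord → ℂ) : eval x ρ = eval (Sum.elim x (differential f x)) F := by
      change eval x (aeval (Sum.elim X fun j => pderiv j f) F) = _
      rw [← aeval_eq_eval, ← aeval_eq_eval, ← AlgHom.comp_apply, comp_aeval]
      congr 2
      ext i
      rcases i with i | i <;> simp [differential, aeval_eq_eval]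
    suffices h : ρ ∈ vanishingIdeal ℂ kashiwaraSaitoVariety by
      rw [← hρ]
      exact mem_vanishingIdeal_iff_eval.1 h p hp.1
    rw [← vanishingIdeal_eq_of_bigCell_subset subset_rfl fun x hx => hx.1,
      mem_vanishingIdeal_iff_eval]
    intro x hx
    have hx' := mem_variety_iff.1 hx.1
    have hxc := eq_chart_of_equations hx.2 (fun i => (hx' i).1) fun i => (hx' i).2 1 0
    obtain ⟨m, s, hms⟩ := exists_conormalChart_eq (z := fun i => x (i, 1, 1) / x (i, 1, 0))
      hx.2 hf
    rw [← hxc] at hms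
    rw [hρ, hms]
    refine hF _ ⟨fun k => ![fun i => x (i, 1, 1) / x (i, 1, 0), fun i => x (i, 1, 0), m, s]
      k.1 k.2, ?_⟩
    exact congrArg₂ Sum.elim hxc.symm rfl
  · refine zariskiClosure_subset_iff.2 ?_
    rintro _ ⟨t, rfl⟩
    let γ : ℂ → Fin 4 × Fin 4 → ℂ := fun s k => t k + if k.1 = 1 then s else 0
    have hγ : Continuous γ := by
      refine continuous_pi fun k => ?_
      by_cases h : k.1 = 1 <;> simp [γ, h] <;> fun_prop
    have hγ₀ : γ 0 = t := by ext k; simp [γ]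
    rw [← hγ₀]
    refine (isClosed_zariskiClosure _).mem_of_tendsto
      (((continuous_bundleChart.comp hγ).tendsto 0).mono_left nhdsWithin_le_nhds)
      (b := nhdsWithin 0 {0}ᶜ) ?_
    filter_upwards [Filter.eventually_all.2 fun i => eventually_add_ne_zero (t (1, i))] with s hs
    exact subset_zariskiClosure _ (conormalChart_mem_conormalBundle (by simpa [γ] using hs))

/-! ### The discriminant of a cyclic product -/

/-- The discriminant of the characteristic polynomial of `B₀ B₁ B₂ B₃`. -/
def cyclicDisc {R : Type*} [CommRing R] (B : Fin 4 → Matrix (Fin 2) (Fin 2) R) : R :=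
  (B 0 * B 1 * B 2 * B 3).trace ^ 2 - 4 * (B 0 * B 1 * B 2 * B 3).det

theorem map_cyclicDisc {R S : Type*} [CommRing R] [CommRing S] (f : R →+* S)
    (B : Fin 4 → Matrix (Fin 2) (Fin 2) R) :
    f (cyclicDisc B) = cyclicDisc fun i => (B i).map f := by
  simp only [cyclicDisc, map_sub, map_pow, map_mul, map_ofNat, RingHom.map_det,
    RingHom.mapMatrix_apply, ← Matrix.map_mul, Matrix.trace_fin_two, map_add, Matrix.map_apply]

/-- The discriminant of a cyclic product of matrices that are triangular in suitable bases. -/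
theorem cyclicDisc_eq_sq {R : Type*} [CommRing R] {B P : Fin 4 → Matrix (Fin 2) (Fin 2) R}
    {l m o : Fin 4 → R} (hP : IsUnit (P 3).det)
    (h : ∀ i, B i * P i = P (i - 1) * !![l i, o i; 0, m i]) :
    cyclicDisc B = (∏ i, l i - ∏ i, m i) ^ 2 := by
  set T : Fin 4 → Matrix (Fin 2) (Fin 2) R := fun i => !![l i, o i; 0, m i] with hT
  have h' (i : Fin 4) (N : Matrix (Fin 2) (Fin 2) R) :
      B i * (P i * N) = P (i - 1) * (T i * N) := by
    rw [← Matrix.mul_assoc, h, Matrix.mul_assoc]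
  have h₀ (N) : B 0 * (P 0 * N) = P 3 * (T 0 * N) := h' 0 N
  have h₁ (N) : B 1 * (P 1 * N) = P 0 * (T 1 * N) := h' 1 N
  have h₂ (N) : B 2 * (P 2 * N) = P 1 * (T 2 * N) := h' 2 N
  have h₃ : B 3 * P 3 = P 2 * T 3 := h 3
  -- The base changes telescope, and the cycle closes because `0 - 1 = 3` in `Fin 4`.
  have hM : B 0 * B 1 * B 2 * B 3 = P 3 * (T 0 * T 1 * T 2 * T 3) * (P 3)⁻¹ := by
    rw [← Matrix.mul_nonsing_inv_cancel_right _ (B 0 * B 1 * B 2 * B 3) hP]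
    congr 1
    simp only [Matrix.mul_assoc, h₃, h₂, h₁, h₀]
  rw [cyclicDisc, hM, Matrix.trace_mul_comm, ← Matrix.mul_assoc, Matrix.nonsing_inv_mul _ hP,
    Matrix.one_mul, Matrix.det_conj ((Matrix.isUnit_iff_isUnit_det _).2 hP)]
  simp [hT, Matrix.det_fin_two, Matrix.trace_fin_two, Fin.prod_univ_four]
  ring

theorem cyclicDisc_conj {R : Type*} [CommRing R] (B : Fin 4 → Matrix (Fin 2) (Fin 2) R)
    {E F : Matrix (Fin 2) (Fin 2) R} (h : F * E = 1) :
    cyclicDisc (fun i => E * B i * F) = cyclicDisc B := by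
  have hM : E * B 0 * F * (E * B 1 * F) * (E * B 2 * F) * (E * B 3 * F) =
      E * (B 0 * B 1 * B 2 * B 3) * F := by
    simp only [Matrix.mul_assoc]
    simp only [← Matrix.mul_assoc F E, h, Matrix.one_mul]
  rw [cyclicDisc, cyclicDisc, hM, Matrix.trace_mul_comm, ← Matrix.mul_assoc, h, Matrix.one_mul,
    Matrix.det_mul_right_comm, mul_eq_one_comm.1 h, Matrix.one_mul]

/-- The covector with given blocks. -/
def ofBlocks (B : Fin 4 → Matrix (Fin 2) (Fin 2) ℂ) : Coord → ℂ := fun p => B p.1 p.2.1 p.2.2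

theorem block_ofBlocks (B : Fin 4 → Matrix (Fin 2) (Fin 2) ℂ) : block (ofBlocks B) = B := rfl

theorem ofBlocks_block (ξ : Coord → ℂ) : ofBlocks (block ξ) = ξ := rfl

/-- The equation of the dual cone. -/
def discPoly : MvPolynomial Coord ℂ :=
  cyclicDisc fun i => Matrix.of fun a b => X (i, a, b)

theorem eval_discPoly (ξ : Coord → ℂ) : eval ξ discPoly = cyclicDisc (block ξ) := by
  rw [discPoly, map_cyclicDisc]
  congr 1
  ext i a b
  simp [block]

theorem discPoly_ne_zero : discPoly ≠ 0 := by
  intro h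
  have := eval_discPoly (ofBlocks ![!![1, 0; 0, 0], 1, 1, 1])
  rw [h, block_ofBlocks] at this
  simp [cyclicDisc, Matrix.det_fin_two] at this

/-- In the bases $(1,z_i),(0,1)$ the blocks are triangular, and both diagonal products equal $\prod
m_i\prod c_i$ after cyclic reindexing. -/
theorem cyclicDisc_conormalChart (z c m s : Fin 4 → ℂ) :
    cyclicDisc (block (conormalChart z c m s)) = 0 := by
  rw [cyclicDisc_eq_sq (P := fun i => !![1, 0; z i, 1]) (l := fun i => m (i - 1) * c (i - 1))
    (m := fun i => m i * c (i + 1)) (o := fun i => -s i) (by simp [Matrix.det_fin_two])]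
  · have hsub (g : Fin 4 → ℂ) : ∏ i, g (i - 1) = ∏ i, g i :=
      Equiv.prod_comp (Equiv.subRight (1 : Fin 4)) g
    have hadd (g : Fin 4 → ℂ) : ∏ i, g (i + 1) = ∏ i, g i :=
      Equiv.prod_comp (Equiv.addRight (1 : Fin 4)) g
    rw [Finset.prod_mul_distrib, Finset.prod_mul_distrib, hsub, hsub, hadd, sub_self,
      zero_pow two_ne_zero]
  · intro i
    ext a b
    fin_cases a <;> fin_cases b <;> simp [block, conormalChart, Matrix.mul_apply] <;> ring

/-! ### Points of the dual cone -/

/-- The covector involves `c` and `m` only through products `m i * c j`, so it is unchanged by `(ε •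
c, ε⁻¹ • m)`, while the base point tends to 0. -/
theorem conormalChart_mem_dualCone (z c m s : Fin 4 → ℂ) :
    conormalChart z c m s ∈ dualCone (smoothPart kashiwaraSaitoVariety) := by
  have h : Filter.Tendsto
      (fun ε : ℂ => Sum.elim (ε • chart z c) (conormalChart z c m s)) (nhdsWithin 0 {0}ᶜ)
      (nhds (Sum.elim ((0 : ℂ) • chart z c) (conormalChart z c m s))) := by
    refine Filter.Tendsto.mono_left (Continuous.tendsto ?_ 0) nhdsWithin_le_nhds
    refine continuous_pi fun j => ?_
    rcases j with j | j <;> simp <;> fun_prop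
  rw [zero_smul] at h
  change _ ∈ zariskiClosure _
  refine (isClosed_zariskiClosure _).mem_of_tendsto h (b := nhdsWithin 0 {0}ᶜ) ?_
  filter_upwards [self_mem_nhdsWithin] with ε hε
  have hε : ε ≠ 0 := hε
  have h₁ : ε • chart z c = chart z (ε • c) := by
    ext p
    simp [chart]
    ring
  have h₂ : conormalChart z c m s = conormalChart z (ε • c) (ε⁻¹ • m) s := by
    have (i j : Fin 4) : ε⁻¹ * m i * (ε * c j) = m i * c j := by field_simp
    ext p
    simp [conormalChart, this]
  change _ ∈ conormalVariety (smoothPart kashiwaraSaitoVariety)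
  rw [conormalVariety_eq, h₁, h₂]
  exact subset_zariskiClosure _
    ⟨fun k => ![z, ε • c, ε⁻¹ • m, s] k.1 k.2, rfl⟩

theorem isClosed_dualCone {σ : Type*} [Fintype σ] (S : Set (σ → ℂ)) : IsClosed (dualCone S) := by
  refine (isClosed_zariskiClosure _).preimage (f := fun ξ => Sum.elim (0 : σ → ℂ) ξ) ?_
  refine continuous_pi fun j => ?_
  rcases j with j | j <;> simp <;> fun_prop

/-- A cycle of invertible matrices with a cycle of lines is in the chart. -/
theorem exists_eq_conormalChart {B : Fin 4 → Matrix (Fin 2) (Fin 2) ℂ} (hB : cyclicDisc B = 0)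
    (hdet : ∀ i, (B i).det ≠ 0) {w : Fin 4 → Fin 2 → ℂ} (hw : ∀ i, w i 0 ≠ 0) {κ : Fin 4 → ℂ}
    (hBw : ∀ i, (B i).mulVec (w i) = κ i • w (i - 1)) :
    ∃ z c m s : Fin 4 → ℂ, ofBlocks B = conormalChart z c m s := by
  let z : Fin 4 → ℂ := fun i => w i 1 / w i 0
  -- `l` and `μ` are the diagonal entries of the blocks in the bases $(1,z_i),(0,1)$.
  let l : Fin 4 → ℂ := fun i => B i 0 0 + z i * B i 0 1
  let μ : Fin 4 → ℂ := fun i => B i 1 1 - z (i - 1) * B i 0 1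
  have hz (i : Fin 4) : B i 1 0 + z i * B i 1 1 = z (i - 1) * l i := by
    have h₀ : B i 0 0 * w i 0 + B i 0 1 * w i 1 = κ i * w (i - 1) 0 := by
      simpa [Matrix.mulVec, dotProduct] using congrFun (hBw i) 0
    have h₁ : B i 1 0 * w i 0 + B i 1 1 * w i 1 = κ i * w (i - 1) 1 := by
      simpa [Matrix.mulVec, dotProduct] using congrFun (hBw i) 1
    have := hw i
    have := hw (i - 1)
    simp only [l, z]
    field_simp
    linear_combination w (i - 1) 0 * h₁ - w (i - 1) 1 * h₀
  have hlμ (i : Fin 4) : l i * μ i = (B i).det := by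
    rw [Matrix.det_fin_two]
    have := hz i
    simp only [l, μ] at this ⊢
    linear_combination B i 0 1 * this
  have hl (i : Fin 4) : l i ≠ 0 := left_ne_zero_of_mul (hlμ i ▸ hdet i)
  have hμ (i : Fin 4) : μ i ≠ 0 := right_ne_zero_of_mul (hlμ i ▸ hdet i)
  have hprod : ∏ i, l i = ∏ i, μ i := by
    rw [cyclicDisc_eq_sq (P := fun i => !![1, 0; z i, 1]) (l := l) (m := μ)
      (o := fun i => B i 0 1) (by simp [Matrix.det_fin_two])] at hB
    · exact sub_eq_zero.1 (pow_eq_zero_iff two_ne_zero |>.1 hB)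
    · intro i
      ext a b
      have := hz i
      fin_cases a <;> fin_cases b <;> simp [Matrix.mul_apply]
      · simp only [l]; ring
      · linear_combination this
      · simp only [μ]; ring
  rw [Fin.prod_univ_four, Fin.prod_univ_four] at hprod
  -- Matching both diagonals forces $\mu_{i-1}c_{i-1}=l_ic_i$. This recursion is solved from
  -- $c_0=1$; it closes up at $i=0$ exactly because $\prod l_i=\prod\mu_i$.
  let c : Fin 4 → ℂ := ![1, μ 0 / l 1, μ 0 * μ 1 / (l 1 * l 2),
    μ 0 * μ 1 * μ 2 / (l 1 * l 2 * l 3)]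
  have hc (i : Fin 4) : c i ≠ 0 := by fin_cases i <;> simp [c, hl, hμ]
  have hcl (i : Fin 4) : μ (i - 1) * c (i - 1) = l i * c i := by
    have := hl 1
    have := hl 2
    have := hl 3
    fin_cases i <;> simp [c]
    · change μ 3 * _ = _
      field_simp
      linear_combination -hprod
    · field_simp
    · field_simp
    · change μ 2 * _ = _
      field_simp
  have h₁ (i : Fin 4) : μ (i - 1) / c i * c (i - 1) = l i := by
    rw [div_mul_eq_mul_div, hcl, mul_div_cancel_right₀ _ (hc i)]
  have h₂ (i : Fin 4) : μ i / c (i + 1) * c (i + 1) = μ i := div_mul_cancel₀ _ (hc _)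
  refine ⟨z, c, fun i => μ i / c (i + 1), fun i => -B i 0 1, ?_⟩
  ext ⟨i, a, b⟩
  have := hz i
  fin_cases a <;> fin_cases b <;> simp [conormalChart, ofBlocks, h₁, h₂]
  · simp only [l]; ring
  · simp only [l, μ] at this ⊢; linear_combination this
  · simp only [μ]; ring

theorem exists_mulVec_eq_smul (B : Matrix (Fin 2) (Fin 2) ℂ) {v : Fin 2 → ℂ} (hv : v ≠ 0) :
    ∃ w : Fin 2 → ℂ, w ≠ 0 ∧ ∃ κ : ℂ, B.mulVec w = κ • v := by
  by_cases h : B.det = 0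
  · obtain ⟨w, hw, hBw⟩ := Matrix.exists_mulVec_eq_zero_iff.2 h
    exact ⟨w, hw, 0, by simpa using hBw⟩
  · have hBw : B.mulVec (B.adjugate.mulVec v) = B.det • v := by
      rw [Matrix.mulVec_mulVec, Matrix.mul_adjugate, Matrix.smul_mulVec, Matrix.one_mulVec]
    refine ⟨B.adjugate.mulVec v, fun h0 => ?_, _, hBw⟩
    rw [h0, Matrix.mulVec_zero] at hBw
    exact (smul_ne_zero h hv) hBw.symm

/-- A cycle of matrices one of which is singular preserves a cycle of lines. -/
theorem exists_lines_of_singular (B : Fin 4 → Matrix (Fin 2) (Fin 2) ℂ) {j : Fin 4}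
    (hj : (B j).det = 0) : ∃ (w : Fin 4 → Fin 2 → ℂ) (κ : Fin 4 → ℂ), (∀ i, w i ≠ 0) ∧
      ∀ i, (B i).mulVec (w i) = κ i • w (i - 1) := by
  -- Starting from a kernel vector of `B j`, lines are pulled back around the cycle; it closes since
  -- `B j` sends `w₀` to 0, which lies in every line.
  obtain ⟨w₀, h₀, hB₀⟩ := Matrix.exists_mulVec_eq_zero_iff.2 hj
  obtain ⟨w₁, h₁, κ₁, hB₁⟩ := exists_mulVec_eq_smul (B (j + 1)) h₀
  obtain ⟨w₂, h₂, κ₂, hB₂⟩ := exists_mulVec_eq_smul (B (j + 2)) h₁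
  obtain ⟨w₃, h₃, κ₃, hB₃⟩ := exists_mulVec_eq_smul (B (j + 3)) h₂
  have hW : ∀ k, ![w₀, w₁, w₂, w₃] k ≠ 0 := by
    intro k
    fin_cases k <;> assumption
  have hB : ∀ k, (B (j + k)).mulVec (![w₀, w₁, w₂, w₃] k) =
      ![0, κ₁, κ₂, κ₃] k • ![w₀, w₁, w₂, w₃] (k - 1) := by
    intro k
    fin_cases k
    · simpa using hB₀
    exacts [hB₁, hB₂, hB₃]
  refine ⟨fun i => ![w₀, w₁, w₂, w₃] (i - j), fun i => ![0, κ₁, κ₂, κ₃] (i - j),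
    fun i => hW _, fun i => ?_⟩
  have := hB (i - j)
  rwa [add_sub_cancel, sub_right_comm] at this

/-- A cycle of invertible matrices preserves a cycle of lines. -/
theorem exists_lines_of_det_ne_zero (B : Fin 4 → Matrix (Fin 2) (Fin 2) ℂ)
    (hB : ∀ i, (B i).det ≠ 0) : ∃ (w : Fin 4 → Fin 2 → ℂ) (κ : Fin 4 → ℂ), (∀ i, w i ≠ 0) ∧
      ∀ i, (B i).mulVec (w i) = κ i • w (i - 1) := by
  have hne (i : Fin 4) {v : Fin 2 → ℂ} (hv : v ≠ 0) : (B i).mulVec v ≠ 0 := fun h =>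
    hB i (Matrix.exists_mulVec_eq_zero_iff.1 ⟨v, hv, h⟩)
  obtain ⟨κ, hκ⟩ := Module.End.exists_eigenvalue (Matrix.toLin' (B 0 * B 1 * B 2 * B 3))
  obtain ⟨v, hv⟩ := hκ.exists_hasEigenvector
  have hv' := hv.apply_eq_smul
  rw [Matrix.toLin'_apply] at hv'
  have h₃ := hne 3 hv.2
  have h₂ := hne 2 h₃
  have h₁ := hne 1 h₂
  -- An eigenvector of the full product is pushed around the cycle; its eigenvalue appears only in
  -- the last step, at index 0.
  refine ⟨![(B 1).mulVec ((B 2).mulVec ((B 3).mulVec v)), (B 2).mulVec ((B 3).mulVec v),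
    (B 3).mulVec v, v], ![κ, 1, 1, 1], fun i => ?_, fun i => ?_⟩
  · fin_cases i
    exacts [h₁, h₂, h₃, hv.2]
  · fin_cases i
    · change (B 0).mulVec ((B 1).mulVec ((B 2).mulVec ((B 3).mulVec v))) = κ • v
      rw [← hv']
      simp only [Matrix.mulVec_mulVec, Matrix.mul_assoc]
    all_goals exact (one_smul ℂ _).symm

theorem eventually_add_mul_ne_zero {v : Fin 2 → ℂ} (hv : v ≠ 0) :
    ∀ᶠ s : ℂ in nhdsWithin 0 {0}ᶜ, v 0 + s * v 1 ≠ 0 := by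
  by_cases h : v 1 = 0
  · have h0 : v 0 ≠ 0 := fun h0 => hv (by ext k; fin_cases k <;> simp [h0, h])
    simp [h, h0]
  · filter_upwards [eventually_add_ne_zero (v 0 / v 1)] with s hs h'
    exact hs (by field_simp; linear_combination h')

/-- The chart needs lines with nonzero first coordinate. Conjugation by a small shear achieves this
for all four lines and preserves the discriminant; the shear then tends to the identity. -/
theorem mem_dualCone_of_det_ne_zero {B : Fin 4 → Matrix (Fin 2) (Fin 2) ℂ}
    (hB : cyclicDisc B = 0) (hdet : ∀ i, (B i).det ≠ 0) :
    ofBlocks B ∈ dualCone (smoothPart kashiwaraSaitoVariety) := by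
  obtain ⟨w, κ, hw, hBw⟩ := exists_lines_of_det_ne_zero B hdet
  let E : ℂ → Matrix (Fin 2) (Fin 2) ℂ := fun s => !![1, s; 0, 1]
  have hE (s : ℂ) : E (-s) * E s = 1 := by
    ext a b
    fin_cases a <;> fin_cases b <;> simp [E, Matrix.mul_apply]
  have hEc : Continuous E := by
    refine continuous_matrix fun a b => ?_
    fin_cases a <;> fin_cases b <;> simp [E] <;> fun_prop
  let γ : ℂ → Coord → ℂ := fun s => ofBlocks fun i => E s * B i * E (-s)
  have hγ : Continuous γ := by
    refine continuous_pi fun p => ?_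
    have : Continuous fun s => E s * B p.1 * E (-s) :=
      (hEc.matrix_mul continuous_const).matrix_mul (hEc.comp continuous_neg)
    exact this.matrix_elem _ _
  have hγ₀ : γ 0 = ofBlocks B := by
    have : E 0 = 1 := by
      ext a b
      fin_cases a <;> fin_cases b <;> simp [E]
    simp [γ, this]
  rw [← hγ₀]
  refine (isClosed_dualCone _).mem_of_tendsto ((hγ.tendsto 0).mono_left nhdsWithin_le_nhds)
    (b := nhdsWithin 0 {0}ᶜ) ?_
  filter_upwards [Filter.eventually_all.2 fun i => eventually_add_mul_ne_zero (hw i)] with s hs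
  obtain ⟨z, c, m, o, h⟩ := exists_eq_conormalChart (B := fun i => E s * B i * E (-s))
    (w := fun i => (E s).mulVec (w i)) (κ := κ)
    (by rw [cyclicDisc_conj B (hE s), hB])
    (fun i => by
      have hE₁ (s : ℂ) : (E s).det = 1 := by simp [E, Matrix.det_fin_two]
      rw [Matrix.det_mul, Matrix.det_mul, hE₁, hE₁, one_mul, mul_one]
      exact hdet i)
    (fun i => by simpa [E, Matrix.mulVec, dotProduct] using hs i)
    (fun i => by
      rw [Matrix.mulVec_mulVec, Matrix.mul_assoc, hE, Matrix.mul_one, ← Matrix.mulVec_mulVec, hBw,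
        Matrix.mulVec_smul])
  rw [show γ s = _ from h]
  exact conormalChart_mem_dualCone z c m o

/-- Two tuples of complex numbers with the same product that vanishes can be deformed into tuples
of nonzero numbers with the same product. -/
theorem exists_deformation {ι : Type*} [Fintype ι] [DecidableEq ι] {l m : ι → ℂ}
    {i j : ι} (hi : l i = 0) (hj : m j = 0) :
    ∃ L M : ℂ → ι → ℂ, Continuous L ∧ Continuous M ∧ L 0 = l ∧ M 0 = m ∧
      (∀ s, ∏ k, L s k = ∏ k, M s k) ∧
      ∀ᶠ s : ℂ in nhdsWithin 0 {0}ᶜ, ∀ k, L s k ≠ 0 ∧ M s k ≠ 0 := by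
  -- All entries are shifted by `s`, except that the one at the zero of each tuple becomes `s` times
  -- the other tuple's remaining product. Both total products are then the same symmetric
  -- expression.
  let p (a : ι → ℂ) (k : ι) (s : ℂ) : ℂ := ∏ q ∈ Finset.univ.erase k, (a q + s)
  let D (a b : ι → ℂ) (k q : ι) (s : ℂ) : ι → ℂ :=
    Function.update (fun r => a r + s) k (s * p b q s)
  have hcont (a b : ι → ℂ) (k q : ι) : Continuous (D a b k q) := by
    refine continuous_pi fun r => ?_
    by_cases h : r = k
    · subst h
      simp only [D, Function.update_self, p]
      fun_prop
    · simp only [D, Function.update_of_ne h]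
      fun_prop
  have hzero (a b : ι → ℂ) (k q : ι) (h : a k = 0) : D a b k q 0 = a := by
    ext r
    by_cases hr : r = k
    · subst hr
      simp [D, h]
    · simp [D, hr]
  have hprod (a b : ι → ℂ) (k q : ι) (s : ℂ) : ∏ r, D a b k q s r = s * p b q s * p a k s := by
    rw [← Finset.mul_prod_erase _ _ (Finset.mem_univ k)]
    congr 1
    · simp [D]
    · exact Finset.prod_congr rfl fun r hr => by simp [D, Finset.ne_of_mem_erase hr]
  have hne (a b : ι → ℂ) (k q : ι) :
      ∀ᶠ s : ℂ in nhdsWithin 0 {0}ᶜ, ∀ r, D a b k q s r ≠ 0 := by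
    filter_upwards [Filter.eventually_all.2 fun r => eventually_add_ne_zero (a r),
      Filter.eventually_all.2 fun r => eventually_add_ne_zero (b r),
      self_mem_nhdsWithin] with s ha hb hs r
    by_cases hr : r = k
    · subst hr
      simp only [D, Function.update_self]
      exact mul_ne_zero hs (Finset.prod_ne_zero_iff.2 fun q _ => hb q)
    · simpa [D, hr] using ha r
  refine ⟨D l m i j, D m l j i, hcont _ _ _ _, hcont _ _ _ _, hzero _ _ _ _ hi, hzero _ _ _ _ hj,
    fun s => by rw [hprod, hprod]; ring, ?_⟩
  filter_upwards [hne l m i j, hne m l j i] with s h₁ h₂ k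
  exact ⟨h₁ k, h₂ k⟩

theorem exists_det_one_col {v : Fin 2 → ℂ} (hv : v ≠ 0) :
    ∃ P : Matrix (Fin 2) (Fin 2) ℂ, P.det = 1 ∧ ∀ a, P a 0 = v a := by
  by_cases h : v 0 = 0
  · have h1 : v 1 ≠ 0 := fun h1 => hv (by ext k; fin_cases k <;> simp [h1, h])
    refine ⟨!![v 0, -(v 1)⁻¹; v 1, 0], by simp [Matrix.det_fin_two, h1], fun a => ?_⟩
    fin_cases a <;> rfl
  · refine ⟨!![v 0, 0; v 1, (v 0)⁻¹], by simp [Matrix.det_fin_two, h], fun a => ?_⟩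
    fin_cases a <;> rfl

/-- In bases adapted to an invariant cycle of lines the blocks are triangular. The two diagonal
products agree and, one block being singular, both vanish, so `exists_deformation` yields nearby
invertible cycles with zero discriminant. -/
theorem mem_dualCone_of_singular {B : Fin 4 → Matrix (Fin 2) (Fin 2) ℂ}
    (hB : cyclicDisc B = 0) {j : Fin 4} (hj : (B j).det = 0) :
    ofBlocks B ∈ dualCone (smoothPart kashiwaraSaitoVariety) := by
  obtain ⟨w, κ, hw, hBw⟩ := exists_lines_of_singular B hj
  choose P hP hPw using fun i => exists_det_one_col (hw i)
  have hPu (i : Fin 4) : IsUnit (P i).det := by simp [hP]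
  have hadj (i : Fin 4) : P i * (P i).adjugate = 1 := by rw [Matrix.mul_adjugate, hP, one_smul]
  have hadj' (i : Fin 4) : (P i).adjugate * P i = 1 := by rw [Matrix.adjugate_mul, hP, one_smul]
  let T : Fin 4 → Matrix (Fin 2) (Fin 2) ℂ := fun i => (P (i - 1)).adjugate * B i * P i
  have hBP (i : Fin 4) : B i * P i = P (i - 1) * T i := by
    simp only [T, ← Matrix.mul_assoc, hadj, Matrix.one_mul]
  have hT10 (i : Fin 4) : T i 1 0 = 0 := by
    have hcol : (P i).mulVec (Pi.single 0 1) = w i := by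
      ext a
      simp [hPw]
    have hcol' : (P (i - 1)).mulVec (Pi.single 0 1) = w (i - 1) := by
      ext a
      simp [hPw]
    have : (T i).mulVec (Pi.single 0 1) = κ i • Pi.single 0 1 := by
      simp only [T]
      rw [← Matrix.mulVec_mulVec, hcol, ← Matrix.mulVec_mulVec, hBw, ← hcol', Matrix.mulVec_smul,
        Matrix.mulVec_mulVec, hadj', Matrix.one_mulVec]
    simpa using congrFun this 1
  have hT (i : Fin 4) : T i = !![T i 0 0, T i 0 1; 0, T i 1 1] := by
    conv_lhs => rw [Matrix.eta_fin_two (T i), hT10]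
  have hprod : ∏ i, T i 0 0 = ∏ i, T i 1 1 := by
    rw [cyclicDisc_eq_sq (hPu 3) (fun i => by rw [hBP, hT])] at hB
    exact sub_eq_zero.1 (pow_eq_zero_iff two_ne_zero |>.1 hB)
  have hdet : T j 0 0 * T j 1 1 = 0 := by
    have h : (T j).det = 0 := by simp [T, Matrix.det_mul, hj]
    rw [hT, Matrix.det_fin_two] at h
    simpa using h
  obtain ⟨i, k, hi, hk⟩ : ∃ i k, T i 0 0 = 0 ∧ T k 1 1 = 0 := by
    have h₁ : ∏ i, T i 0 0 = 0 := by
      rcases mul_eq_zero.1 hdet with h | h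
      · exact Finset.prod_eq_zero (Finset.mem_univ j) h
      · rw [hprod]
        exact Finset.prod_eq_zero (Finset.mem_univ j) h
    obtain ⟨i, -, hi⟩ := Finset.prod_eq_zero_iff.1 h₁
    obtain ⟨k, -, hk⟩ := Finset.prod_eq_zero_iff.1 (hprod ▸ h₁)
    exact ⟨i, k, hi, hk⟩
  obtain ⟨L, M, hL, hM, hL₀, hM₀, hLM, hne⟩ := exists_deformation
    (l := fun i => T i 0 0) (m := fun i => T i 1 1) hi hk
  let N : Fin 4 → ℂ → Matrix (Fin 2) (Fin 2) ℂ := fun i s =>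
    P (i - 1) * !![L s i, T i 0 1; 0, M s i] * (P i).adjugate
  have hN (i : Fin 4) : Continuous (N i) := by
    refine (continuous_const.matrix_mul (continuous_matrix fun a b => ?_)).matrix_mul
      continuous_const
    fin_cases a <;> fin_cases b <;> simp <;> fun_prop
  have hN₀ (i : Fin 4) : N i 0 = B i := by
    simp only [N, hL₀, hM₀, ← hT, ← hBP]
    rw [Matrix.mul_assoc, hadj, Matrix.mul_one]
  have hγ : Continuous fun s => ofBlocks fun i => N i s :=
    continuous_pi fun p => (hN p.1).matrix_elem _ _
  have hγ₀ : ofBlocks B = ofBlocks fun i => N i 0 := by simp only [hN₀]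
  rw [hγ₀]
  refine (isClosed_dualCone _).mem_of_tendsto ((hγ.tendsto 0).mono_left nhdsWithin_le_nhds)
    (b := nhdsWithin 0 {0}ᶜ) ?_
  filter_upwards [hne] with s hs
  refine mem_dualCone_of_det_ne_zero ?_ fun i => ?_
  · rw [cyclicDisc_eq_sq (P := P) (l := L s) (m := M s) (o := fun i => T i 0 1) (hPu 3) fun i => ?_,
      hLM, sub_self, zero_pow two_ne_zero]
    simp only [N]
    rw [Matrix.mul_assoc, hadj', Matrix.mul_one]
  · simp [N, Matrix.det_mul, Matrix.det_adjugate, hP, Matrix.det_fin_two, hs i]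

/-! ### The dual cone as a hypersurface -/

theorem dualCone_eq : dualCone (smoothPart kashiwaraSaitoVariety) =
    {ξ | eval ξ discPoly = 0} := by
  ext ξ
  rw [Set.mem_ofPred_eq, eval_discPoly]
  refine ⟨fun h => ?_, fun h => ?_⟩
  · rw [dualCone, conormalVariety_eq, Set.mem_ofPred_eq, mem_zariskiClosure_iff] at h
    have := h (rename Sum.inr discPoly) (by
      rintro _ ⟨t, rfl⟩
      rw [eval_rename, bundleChart, Sum.elim_comp_inr, eval_discPoly, cyclicDisc_conormalChart])
    rwa [eval_rename, Sum.elim_comp_inr, eval_discPoly] at this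
  · rw [← ofBlocks_block ξ]
    by_cases hdet : ∀ i, (block ξ i).det ≠ 0
    · exact mem_dualCone_of_det_ne_zero h hdet
    · push Not at hdet
      obtain ⟨j, hj⟩ := hdet
      exact mem_dualCone_of_singular h hj

theorem eval_zero_discPoly : eval 0 discPoly = 0 := by
  have : block (0 : Coord → ℂ) = 0 := rfl
  rw [eval_discPoly, this]
  simp [cyclicDisc]

/-! ### Dimensions -/

theorem conormalVariety_zero {σ : Type*} [Fintype σ] : conormalVariety ({0} : Set (σ → ℂ)) =
    (fun ξ : σ → ℂ => Sum.elim (0 : σ → ℂ) ξ) '' Set.univ := by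
  apply Set.Subset.antisymm
  · intro y hy
    refine ⟨y ∘ Sum.inr, trivial, ?_⟩
    ext (i | i)
    · have := mem_zariskiClosure_iff.1 hy (X (Sum.inl i)) (by
        rintro _ ⟨p, ξ, rfl, rfl, -⟩
        simp)
      simpa using this.symm
    · rfl
  · rintro _ ⟨ξ, -, rfl⟩
    refine subset_zariskiClosure _ ⟨0, ξ, rfl, rfl, fun v hv => ?_⟩
    have hv₀ (i : σ) : v i = 0 := by
      have := mem_tangentSpace_iff.1 hv (X i) (mem_vanishingIdeal_iff_eval.2 (by simp))
      rwa [directional_X] at this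
    simp [hv₀]

theorem dimension_univ {σ : Type*} [Fintype σ] :
    dimension (Set.univ : Set (σ → ℂ)) = Fintype.card σ := by
  have : vanishingIdeal ℂ (Set.univ : Set (σ → ℂ)) = ⊥ := by
    refine eq_bot_iff.2 fun f hf => ?_
    rw [mem_vanishingIdeal_iff_eval] at hf
    exact MvPolynomial.funext fun x => by simpa using hf x trivial
  rw [dimension, this, ringKrullDim_eq_of_ringEquiv (RingEquiv.quotientBot _),
    MvPolynomial.ringKrullDim_of_isNoetherianRing, ringKrullDim_eq_zero_of_field]
  simp

theorem conormalVariety_inter_zero {σ : Type*} [Fintype σ] (S : Set (σ → ℂ)) :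
    conormalVariety S ∩ conormalVariety {0} =
      (fun ξ : σ → ℂ => Sum.elim (0 : σ → ℂ) ξ) '' dualCone S := by
  rw [conormalVariety_zero, Set.image_univ, Set.inter_comm, ← Set.image_preimage_eq_range_inter]
  rfl

theorem dimension_inter : dimension (conormalVariety (smoothPart kashiwaraSaitoVariety) ∩
    conormalVariety {0}) + 1 = Fintype.card Coord := by
  rw [conormalVariety_inter_zero, dimension_zeroSection, dualCone_eq]
  exact dimension_hypersurface discPoly_ne_zero eval_zero_discPoly

theorem dimension_conormalVariety :
    dimension (conormalVariety (smoothPart kashiwaraSaitoVariety)) = Fintype.card Coord := by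
  apply le_antisymm
  · rw [conormalVariety_eq, dimension_zariskiClosure, range_bundleChart]
    exact dimension_range_le _
  · rw [← dimension_inter]
    -- A base coordinate vanishes over the origin but not at the chart point with all parameters 1,
    -- so the intersection is proper.
    refine dimension_succ_le Set.inter_subset_left ?_ (f := X (Sum.inl (0, 1, 0))) ?_ ?_
    · rw [conormalVariety_eq, vanishingIdeal_zariskiClosure, range_bundleChart]
      exact isPrime_vanishingIdeal_range _
    · rw [conormalVariety_inter_zero, mem_vanishingIdeal_iff_eval]
      rintro _ ⟨ξ, -, rfl⟩
      simp
    · rw [conormalVariety_eq, vanishingIdeal_zariskiClosure, mem_vanishingIdeal_iff_eval]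
      intro h
      have := h _ ⟨1, rfl⟩
      simp [bundleChart, chart] at this

end Microlocal

end


theorem mainTheorem4 :
    Microlocal.MeetMicrolocallyInCodimensionOne
        (Microlocal.smoothPart Microlocal.kashiwaraSaitoVariety)
        ({0} : Set (Microlocal.Coord → ℂ)) ∧
      Microlocal.IsDivisor
        (Microlocal.dualCone (Microlocal.smoothPart Microlocal.kashiwaraSaitoVariety)) := by
  refine ⟨⟨Microlocal.dimension_conormalVariety, ?_, Microlocal.dimension_inter⟩, ?_⟩
  · rw [Microlocal.conormalVariety_zero, Microlocal.dimension_zeroSection,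
      Microlocal.dimension_univ]
  · rw [Microlocal.dualCone_eq]
    exact Microlocal.isDivisor_hypersurface Microlocal.discPoly_ne_zero
      Microlocal.eval_zero_discPoly
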